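/- **Theorem (Completeness).** Let $\mathcal A$ be an infinite set of atomic propositions, and consider formulae of intuitionistic propositional logic built from atoms and $\bot$ by $\wedge,\vee,\supset$. *Bases and derivations.* An atomic rule has the form $((P_1\Rightarrow q_1),\dots,(P_n\Rightarrow q_n))\Rightarrow r$ with $n\ge 0$, $P_i\subseteq\mathcal A$ finite and $q_i,r\in\mathcal A$; a base is a set of atomic rules. A context $(X\!:\!P)$ is a finite list of typed variables $x_1\!:\!p_1,\dots,x_m\!:\!p_m$ with $p_i\in\mathcal A$. Derivations $(X\!:\!P)\vdash_{\mathcal B}\Phi:p$ in a base $\mathcal B$ are the terms (up to renaming of bound variables) generated by: each variable $x\!:\!p$ of the context is a derivation of $p$; and if $\mathcal R=((P_1\Rightarrow q_1),\dots,(P_n\Rightarrow q_n))\Rightarrow r$ is in $\mathcal B$ and $(X\!:\!P),(X_i\!:\!P_i)\vdash_{\mathcal B}\Phi_i:q_i$ for all $i$, then $(X\!:\!P)\vdash_{\mathcal B}\Phi_{\mathcal R}(\Phi_1,\dots,\Phi_n):r$, the variables $X_i$ (one for each atom of $P_i$) being bound. *Worlds.* Let $\mathcal W$ be the category whose objects are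 the pairs $(\mathcal B,(X\!:\!P))$ of a base and a context; a morphism $(\mathcal B,(X\!:\!P))\to(\mathcal C,(Y\!:\!Q))$ exists only if $\mathcal C\subseteq\mathcal B$, and is then a family of derivations $(X\!:\!P)\vdash_{\mathcal B}\Phi_y:q$, one for each variable $y\!:\!q$ of $(Y\!:\!Q)$. Identities are given by the variables, composition by simultaneous substitution. *Interpretation.* For presheaves $F,G:\mathcal W^{op}\to\mathbf{Set}$ let $F\supset G$ be the exponential, $(F\supset G)(w)=\mathrm{Nat}(\mathcal W(-,w)\times F,G)$; for a family $(K_p)_{p\in\mathcal A}$ of presheaves let $(\forall_{\mathcal A}K)(w)=\prod_{p\in\mathcal A}\mathrm{Nat}(\mathcal W(-,w),K_p)$. Define $[\![\phi]\!]:\mathcal W^{op}\to\mathbf{Set}$ by: $[\![p]\!](\mathcal B,(X\!:\!P))$ is the set of derivations $(X\!:\!P)\vdash_{\mathcal B}\Phi:p$, with morphisms acting by substitution; $[\![\phi\wedge\psi]\!]=[\![\phi]\!]\times[\![\psi]\!]$; $[\![\phi\supset\psi]\!]=[\![\phi]\!]\supset[\![\psi]\!]$; $[\![\phi\vee\psi]\!]=\forall_{\mathcal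 A}K$ with $K_p=([\![\phi]\!]\supset[\![p]\!])\supset(([\![\psi]\!]\supset[\![p]\!])\supset[\![p]\!])$; $[\![\bot]\!]=\forall_{\mathcal A}K$ with $K_p=[\![p]\!]$. For a finite set $\Gamma$ of formulae, $[\![\Gamma]\!]=\prod_{\psi\in\Gamma}[\![\psi]\!]$. Write $\Gamma\models\phi$ if there is a natural transformation $[\![\Gamma]\!]\to[\![\phi]\!]$. *Claim.* For every finite set $\Gamma$ of formulae and every formula $\phi$: if $\Gamma\models\phi$, then $\Gamma\vdash\phi$ is derivable in the intuitionistic natural deduction calculus NJ (hypothesis rule, $\bot$-elimination, and the introduction and elimination rules for $\wedge$, $\vee$, $\supset$). -/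

import Mathlib

universe u

namespace CatPTS

/-! ### Formulae and natural deduction -/

/-- Formulae of intuitionistic propositional logic over a type `A` of atoms. -/
inductive Formula (A : Type u) : Type u
  | atom (p : A) : Formula A
  | bot : Formula A
  | and (φ ψ : Formula A) : Formula A
  | or (φ ψ : Formula A) : Formula A
  | imp (φ ψ : Formula A) : Formula A

/-- `NJ Γ φ`: the sequent `Γ ⊢ φ` is derivable in the natural deduction calculus NJ. -/
inductive NJ {A : Type u} : Set (Formula A) → Formula A → Prop
  | ax {Γ : Set (Formula A)} {φ : Formula A} (h : φ ∈ Γ) : NJ Γ φ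
  | botE {Γ : Set (Formula A)} {φ : Formula A} (h : NJ Γ .bot) : NJ Γ φ
  | andI {Γ : Set (Formula A)} {φ ψ : Formula A} (h₁ : NJ Γ φ) (h₂ : NJ Γ ψ) : NJ Γ (.and φ ψ)
  | andE₁ {Γ : Set (Formula A)} {φ ψ : Formula A} (h : NJ Γ (.and φ ψ)) : NJ Γ φ
  | andE₂ {Γ : Set (Formula A)} {φ ψ : Formula A} (h : NJ Γ (.and φ ψ)) : NJ Γ ψ
  | orI₁ {Γ : Set (Formula A)} {φ ψ : Formula A} (h : NJ Γ φ) : NJ Γ (.or φ ψ)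
  | orI₂ {Γ : Set (Formula A)} {φ ψ : Formula A} (h : NJ Γ ψ) : NJ Γ (.or φ ψ)
  | orE {Γ : Set (Formula A)} {φ ψ χ : Formula A} (h : NJ Γ (.or φ ψ))
      (h₁ : NJ (insert φ Γ) χ) (h₂ : NJ (insert ψ Γ) χ) : NJ Γ χ
  | impI {Γ : Set (Formula A)} {φ ψ : Formula A} (h : NJ (insert φ Γ) ψ) : NJ Γ (.imp φ ψ)
  | impE {Γ : Set (Formula A)} {φ ψ : Formula A} (h₁ : NJ Γ φ) (h₂ : NJ Γ (.imp φ ψ)) : NJ Γ ψ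

/-! ### Bases and derivations in a base -/

/-- An atomic rule `((P₁ ⇒ q₁), …, (Pₙ ⇒ qₙ)) ⇒ r`, with finite sets `Pᵢ` of discharged atoms;
`n = 0` is allowed. -/
structure AtomicRule (A : Type u) : Type u where
  premises : List (Finset A × A)
  conclusion : A

/-- A base is a set of atomic rules. -/
abbrev Base (A : Type u) : Type u := Set (AtomicRule A)

/-- Over countably many atoms every base is countable. -/
theorem Base.countable {A : Type u} [Countable A] (B : Base A) : B.Countable := by
  have : Function.Injective (fun R : AtomicRule A => (R.premises, R.conclusion)) := by
    rintro ⟨a, b⟩ ⟨c, d⟩ h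
    cases h
    rfl
  have := this.countable
  exact Set.to_countable B

/-- `Var c p` is the type of variables of type `p` in the context `c`. A context
`x₁ : p₁, …, xₘ : pₘ` is the list `[p₁, …, pₘ]`, its variables being the positions in the list. -/
inductive Var {A : Type u} : List A → A → Type u
  | here {p : A} {c : List A} : Var (p :: c) p
  | there {p q : A} {c : List A} (x : Var c p) : Var (q :: c) p

/-- `Derivation B c p` is the type of derivation terms `c ⊢_B Φ : p`. In an application of a rule,
the context of the `k`-th premise is extended by one bound variable for every discharged atom. -/
inductive Derivation {A : Type u} (B : Base A) : List A → A → Type u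
  | var {c : List A} {p : A} (x : Var c p) : Derivation B c p
  | app {c : List A} (R : AtomicRule A) (hR : R ∈ B)
      (Φ : ∀ k : Fin R.premises.length,
        Derivation B ((R.premises.get k).1.toList ++ c) (R.premises.get k).2) :
      Derivation B c R.conclusion

/-- A renaming of the variables of `c` by variables of `d`. -/
abbrev Renaming {A : Type u} (c d : List A) : Type u := ∀ p : A, Var c p → Var d p

/-- A renaming extended by the identity on the new variables `l`. -/
def Renaming.lift {A : Type u} {c d : List A} (ρ : Renaming c d) :
    ∀ l : List A, Renaming (l ++ c) (l ++ d)
  | [], p, x => ρ p x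
  | _ :: _, _, .here => .here
  | _ :: l, p, .there x => .there (Renaming.lift ρ l p x)

/-- Capture-avoiding renaming of the free variables of a derivation. -/
noncomputable def Derivation.rename {A : Type u} {B : Base A} : ∀ {c d : List A} {p : A},
    Renaming c d → Derivation B c p → Derivation B d p
  | _, _, _, ρ, .var x => .var (ρ _ x)
  | _, _, _, ρ, .app R hR Φ => .app R hR fun k => (Φ k).rename (ρ.lift _)

/-- A family of derivations in `B` from `c`, one for each variable of `d`. -/
abbrev Substitution {A : Type u} (B : Base A) (c d : List A) : Type u :=
  ∀ p : A, Var d p → Derivation B c p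

/-- A substitution extended by the identity on the new variables `l`. -/
noncomputable def Substitution.lift {A : Type u} {B : Base A} {c d : List A} (σ : Substitution B c d) :
    ∀ l : List A, Substitution B (l ++ c) (l ++ d)
  | [], p, x => σ p x
  | _ :: _, _, .here => .var .here
  | _ :: l, p, .there x => (Substitution.lift σ l p x).rename fun _ => .there

/-- Simultaneous capture-avoiding substitution `Φ[σ]`. A derivation `Φ` in a base `C ⊆ B` is at the
same time read as a derivation in `B`. -/
noncomputable def Derivation.subst {A : Type u} {B C : Base A} (h : C ⊆ B) : ∀ {c d : List A} {p : A},
    Substitution B c d → Derivation C d p → Derivation B c p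
  | _, _, _, σ, .var x => σ _ x
  | _, _, _, σ, .app R hR Φ => .app R (h hR) fun k => (Φ k).subst h (σ.lift _)

/-! ### Substitution laws -/

theorem Renaming.lift_comp {A : Type u} {c d e : List A} (ρ : Renaming c d) (τ : Renaming d e)
    (l : List A) : ∀ (p : A) (x : Var (l ++ c) p),
      τ.lift l p (ρ.lift l p x) = Renaming.lift (fun q y => τ q (ρ q y)) l p x := by
  induction l with
  | nil => intro p x; rfl
  | cons a l ih =>
    intro p x
    cases x with
    | here => rfl
    | there x => exact congrArg Var.there (ih p x)

theorem Derivation.rename_rename {A : Type u} {B : Base A} {c : List A} {p : A}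
    (Φ : Derivation B c p) : ∀ {d e : List A} (ρ : Renaming c d) (τ : Renaming d e),
      (Φ.rename ρ).rename τ = Φ.rename fun q y => τ q (ρ q y) := by
  induction Φ with
  | var x => intros; rfl
  | app R hR Φ ih =>
    intro d e ρ τ
    simp only [Derivation.rename, ih]
    congr 1
    funext k
    congr 1
    funext q y
    exact Renaming.lift_comp ρ τ _ q y

theorem Substitution.lift_rename {A : Type u} {B : Base A} {c d e : List A} (ρ : Renaming e d)
    (σ : Substitution B c d) (l : List A) : ∀ (p : A) (x : Var (l ++ e) p),
      σ.lift l p (ρ.lift l p x) = Substitution.lift (fun q y => σ q (ρ q y)) l p x := by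
  induction l with
  | nil => intro p x; rfl
  | cons a l ih =>
    intro p x
    cases x with
    | here => rfl
    | there x => exact congrArg (Derivation.rename fun _ => Var.there) (ih p x)

theorem Derivation.subst_rename {A : Type u} {B C : Base A} (h : C ⊆ B) {e : List A} {p : A}
    (Φ : Derivation C e p) : ∀ {c d : List A} (ρ : Renaming e d) (σ : Substitution B c d),
      (Φ.rename ρ).subst h σ = Φ.subst h fun q y => σ q (ρ q y) := by
  induction Φ with
  | var x => intros; rfl
  | app R hR Φ ih =>
    intro c d ρ σ
    simp only [Derivation.rename, Derivation.subst, ih]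
    congr 1
    funext k
    congr 1
    funext q y
    exact Substitution.lift_rename ρ σ _ q y

theorem Substitution.rename_lift {A : Type u} {B : Base A} {b c d : List A}
    (σ : Substitution B c d) (ρ : Renaming c b) (l : List A) : ∀ (p : A) (x : Var (l ++ d) p),
      (σ.lift l p x).rename (ρ.lift l)
        = Substitution.lift (fun q y => (σ q y).rename ρ) l p x := by
  induction l with
  | nil => intro p x; rfl
  | cons a l ih =>
    intro p x
    cases x with
    | here => rfl
    | there x =>
      simp only [Substitution.lift, ← ih, Derivation.rename_rename]
      rfl

theorem Derivation.rename_subst {A : Type u} {B C : Base A} (h : C ⊆ B) {d : List A} {p : A}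
    (Φ : Derivation C d p) : ∀ {b c : List A} (σ : Substitution B c d) (ρ : Renaming c b),
      (Φ.subst h σ).rename ρ = Φ.subst h fun q y => (σ q y).rename ρ := by
  induction Φ with
  | var x => intros; rfl
  | app R hR Φ ih =>
    intro b c σ ρ
    simp only [Derivation.rename, Derivation.subst, ih]
    congr 1
    funext k
    congr 1
    funext q y
    exact Substitution.rename_lift σ ρ _ q y

theorem Substitution.subst_lift {A : Type u} {B C : Base A} (h : C ⊆ B) {c d e : List A}
    (τ : Substitution C d e) (σ : Substitution B c d) (l : List A) :
    ∀ (p : A) (x : Var (l ++ e) p),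
      (τ.lift l p x).subst h (σ.lift l)
        = Substitution.lift (fun q y => (τ q y).subst h σ) l p x := by
  induction l with
  | nil => intro p x; rfl
  | cons a l ih =>
    intro p x
    cases x with
    | here => rfl
    | there x =>
      simp only [Substitution.lift, ← ih, Derivation.subst_rename, Derivation.rename_subst]
      rfl

/-- Substitution is associative. -/
theorem Derivation.subst_subst {A : Type u} {B C D : Base A} (h : C ⊆ B) (h' : D ⊆ C)
    {e : List A} {p : A} (Φ : Derivation D e p) :
    ∀ {c d : List A} (τ : Substitution C d e) (σ : Substitution B c d),
      (Φ.subst h' τ).subst h σ = Φ.subst (h'.trans h) fun q y => (τ q y).subst h σ := by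
  induction Φ with
  | var x => intros; rfl
  | app R hR Φ ih =>
    intro c d τ σ
    simp only [Derivation.subst, ih]
    congr 1
    funext k
    congr 1
    funext q y
    exact Substitution.subst_lift h τ σ _ q y

theorem Substitution.lift_var {A : Type u} {B : Base A} {c : List A} (l : List A) :
    ∀ (p : A) (x : Var (l ++ c) p),
      Substitution.lift (B := B) (fun _ (y : Var c _) => .var y) l p x = .var x := by
  induction l with
  | nil => intro p x; rfl
  | cons a l ih =>
    intro p x
    cases x with
    | here => rfl
    | there x => simp only [Substitution.lift, ih, Derivation.rename]

theorem Derivation.subst_var {A : Type u} {B : Base A} {c : List A} {p : A}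
    (Φ : Derivation B c p) : Φ.subst subset_rfl (fun _ x => .var x) = Φ := by
  induction Φ with
  | var x => rfl
  | app R hR Φ ih =>
    simp only [Derivation.subst]
    congr 1
    funext k
    refine Eq.trans ?_ (ih k)
    congr 1
    funext q y
    exact Substitution.lift_var _ q y

/-! ### The category of worlds -/

/-- Worlds: pairs of a base and a context. -/
structure World (A : Type u) : Type u where
  base : Base A
  ctx : List A

/-- A morphism from `(B, X : P)` to `(C, Y : Q)`: an inclusion `C ⊆ B` and, for every variable of
`Y : Q`, a derivation in `B` of its atom from `X : P`. -/
@[ext]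
structure World.Hom {A : Type u} (v w : World A) : Type u where
  base_subset : w.base ⊆ v.base
  terms : Substitution v.base v.ctx w.ctx

open CategoryTheory

/-- The category `𝒲`; composition is simultaneous substitution. -/
noncomputable instance World.category (A : Type u) : Category.{u} (World A) where
  Hom v w := World.Hom v w
  id _ := { base_subset := subset_rfl, terms := fun _ x => .var x }
  comp f g :=
    { base_subset := g.base_subset.trans f.base_subset
      terms := fun p x => (g.terms p x).subst f.base_subset f.terms }
  id_comp f := World.Hom.ext (funext fun p => funext fun x => (f.terms p x).subst_var)
  comp_id _ := rfl
  assoc f g h := World.Hom.ext (funext fun p => funext fun x =>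
    ((h.terms p x).subst_subst f.base_subset g.base_subset g.terms f.terms).symm)

/-- Presheaves of sets on `𝒲`. -/
abbrev Presheaf (A : Type u) : Type (u + 1) := (World A)ᵒᵖ ⥤ Type u

/-! ### The interpretation -/

/-- The interpretation of an atom `p`: the derivations of `p`, acted upon by substitution. -/
noncomputable def atomPresheaf {A : Type u} (p : A) : Presheaf A where
  obj w := Derivation w.unop.base w.unop.ctx p
  map f := ↾fun Φ => Derivation.subst f.unop.base_subset f.unop.terms Φ
  map_id w := by
    ext Φ
    exact Derivation.subst_var Φ
  map_comp f g := by
    ext Φ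
    exact (Derivation.subst_subst g.unop.base_subset f.unop.base_subset Φ
      f.unop.terms g.unop.terms).symm

/-- The exponential presheaf, with values `(F ⊃ G)(w) = Nat(Hom(-, w) × F, G)`. -/
noncomputable def expPresheaf {A : Type u} (F G : Presheaf A) : Presheaf A where
  obj w := FunctorToTypes.prod (yoneda.obj w.unop) F ⟶ G
  map f := ↾fun η =>
    FunctorToTypes.prod.lift (FunctorToTypes.prod.fst ≫ yoneda.map f.unop)
      FunctorToTypes.prod.snd ≫ η
  map_id w := by
    ext η : 3
    rw [unop_id, yoneda.map_id, Category.comp_id]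
    rfl
  map_comp f g := by
    ext η : 3
    rw [unop_comp, yoneda.map_comp]
    rfl

/-- The universal quantification `∀_𝒜 K` over atoms of a family `K` of presheaves: its value at `w`
consists of a natural transformation `Hom(-, w) ⟶ K p` for every atom `p`. -/
noncomputable def forallPresheaf {A : Type u} (K : A → Presheaf A) : Presheaf A where
  obj w := ∀ p : A, yoneda.obj w.unop ⟶ K p
  map f := ↾fun η p => yoneda.map f.unop ≫ η p
  map_id w := by
    ext η : 3
    funext p
    simp
  map_comp f g := by
    ext η : 3
    funext p
    simp

/-- The interpretation `⟦φ⟧ : 𝒲ᵒᵖ ⥤ Set` of a formula. -/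
noncomputable def sem {A : Type u} : Formula A → Presheaf A
  | .atom p => atomPresheaf p
  | .bot => forallPresheaf fun p => atomPresheaf p
  | .and φ ψ => FunctorToTypes.prod (sem φ) (sem ψ)
  | .or φ ψ => forallPresheaf fun p =>
      expPresheaf (expPresheaf (sem φ) (atomPresheaf p))
        (expPresheaf (expPresheaf (sem ψ) (atomPresheaf p)) (atomPresheaf p))
  | .imp φ ψ => expPresheaf (sem φ) (sem ψ)

/-- The interpretation `⟦Γ⟧` of a set of formulae: the (component-wise) product of the
interpretations of its members. -/
noncomputable def semSet {A : Type u} (Γ : Set (Formula A)) : Presheaf A where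
  obj w := ∀ ψ : Γ, (sem ψ.1).obj w
  map f := ↾fun x ψ => (sem ψ.1).map f (x ψ)
  map_id w := by
    ext x : 3
    funext ψ
    simp
  map_comp f g := by
    ext x : 3
    funext ψ
    simp

/-- Categorical base-extension validity `Γ ⊨ φ`. -/
def Entails {A : Type u} (Γ : Set (Formula A)) (φ : Formula A) : Prop :=
  Nonempty (semSet Γ ⟶ sem φ)

end CatPTS

/-!
Read every atom `p` as a formula `dec p`, in such a way that all relevant subformulae are readings
of atoms and the relevant atoms are read as themselves, and let `N` be the base of all atomic rules
that are admissible in NJ in the presence of `Γ` under this reading. Over the world `(N, [])`, the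
presheaf `⟦χ⟧` and the presheaf of an atom read as `χ` map into each other, by induction on `χ`: the
introduction and elimination rules of the main connective of `χ` are, under the reading, themselves
rules of `N`. The members of `Γ` are axioms of `N`, so if `Γ ⊨ φ`, then there is a closed
derivation in `N` of an atom read as `φ`. Since the rules of `N` are admissible, `Γ ⊢ φ`.
-/

namespace CatPTS

open CategoryTheory Opposite FunctorToTypes

variable {A : Type u}

/-! ### Presheaves on worlds -/

/-- Associativity of the product of presheaves. -/
noncomputable def prodAssoc (F G H : Presheaf A) : prod (prod F G) H ⟶ prod F (prod G H) :=
  prod.lift (prod.fst ≫ prod.fst) (prod.lift (prod.fst ≫ prod.snd) prod.snd)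

/-- The transpose of a natural transformation across `- × F ⊣ F ⊃ -`. -/
noncomputable def expPresheaf.curry {F G H : Presheaf A} (η : prod H F ⟶ G) :
    H ⟶ expPresheaf F G where
  app _ := ↾fun x => prod.lift (prod.fst ≫ yonedaEquiv.symm x) prod.snd ≫ η
  naturality v w f := by
    ext x : 3
    exact congrArg (fun θ => prod.lift (prod.fst ≫ θ) prod.snd ≫ η) (yonedaEquiv_symm_map f x)

/-- The counit of `- × F ⊣ F ⊃ -`. -/
noncomputable def expPresheaf.eval (F G : Presheaf A) : prod (expPresheaf F G) F ⟶ G where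
  app w := ↾fun z => z.1.app w (𝟙 w.unop, z.2)
  naturality v w f := by
    ext ⟨(η : prod (yoneda.obj v.unop) F ⟶ G), x⟩
    let z : (prod (yoneda.obj v.unop) F).obj v := (𝟙 v.unop, x)
    refine Eq.trans ?_ (NatTrans.naturality_apply η f z)
    exact congrArg (fun g => η.app w (g, F.map f x))
      ((Category.id_comp f.unop).trans (Category.comp_id f.unop).symm)

/-- The universal property of `∀_𝒜 K`: it is the product of the presheaves `K p`. -/
noncomputable def forallPresheaf.lift {K : A → Presheaf A} {H : Presheaf A} (η : ∀ p, H ⟶ K p) :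
    H ⟶ forallPresheaf K where
  app _ := ↾fun x p => yonedaEquiv.symm x ≫ η p
  naturality v w f := by
    ext x : 3
    exact funext fun p => congrArg (· ≫ η p) (yonedaEquiv_symm_map f x)

/-- The projections of `∀_𝒜 K`. -/
noncomputable def forallPresheaf.proj (K : A → Presheaf A) (p : A) : forallPresheaf K ⟶ K p where
  app _ := ↾fun η => yonedaEquiv (η p)
  naturality v w f := by
    ext η
    exact (yonedaEquiv_naturality' (η p) f).symm

/-! ### Context extension -/

/-- A variable of the left part of a concatenated context. -/
def Var.inl (c : List A) : ∀ {l : List A} {p : A}, Var l p → Var (l ++ c) p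
  | _, _, .here => .here
  | _, _, .there x => .there (x.inl c)

/-- A variable of the right part of a concatenated context. -/
def Var.inr {c : List A} {p : A} (x : Var c p) : ∀ l : List A, Var (l ++ c) p
  | [] => x
  | _ :: l => .there (x.inr l)

theorem Var.mem {c : List A} {p : A} (x : Var c p) : p ∈ c := by
  induction x with
  | here => exact List.mem_cons_self
  | there _ ih => exact List.mem_cons_of_mem _ ih

theorem Var.nonempty_of_mem {c : List A} {p : A} (h : p ∈ c) : Nonempty (Var c p) := by
  induction h with
  | head => exact ⟨.here⟩
  | tail _ _ ih => exact ih.map .there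

theorem Derivation.rename_eq_subst {B : Base A} {c d : List A} {p : A} (ρ : Renaming c d)
    (Φ : Derivation B c p) : Φ.rename ρ = Φ.subst subset_rfl fun q x => .var (ρ q x) := by
  rw [← (Φ.rename ρ).subst_var, Derivation.subst_rename]

theorem Substitution.lift_inl {B : Base A} {c d : List A} (σ : Substitution B c d) {l : List A}
    {p : A} (x : Var l p) : σ.lift l p (x.inl d) = .var (x.inl c) := by
  induction x with
  | here => rfl
  | there x ih => simp only [Var.inl, Substitution.lift, ih, Derivation.rename]

theorem Substitution.lift_inr {B : Base A} {c d : List A} (σ : Substitution B c d) {p : A}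
    (x : Var d p) (l : List A) : σ.lift l p (x.inr l) = (σ p x).rename fun _ y => y.inr l := by
  induction l with
  | nil => exact (((σ p x).rename_eq_subst _).trans (σ p x).subst_var).symm
  | cons a l ih => simp only [Var.inr, Substitution.lift, ih, Derivation.rename_rename]

/-- Extension of the context of a world by the variables `l`, as an endofunctor of `𝒲`. -/
noncomputable def World.extend (l : List A) : World A ⥤ World A where
  obj w := ⟨w.base, l ++ w.ctx⟩
  map f := { base_subset := f.base_subset, terms := f.terms.lift l }
  map_id _ := World.Hom.ext (funext fun p => funext fun x => Substitution.lift_var l p x)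
  map_comp f g := World.Hom.ext (funext fun p => funext fun x =>
    (Substitution.subst_lift f.base_subset g.terms f.terms l p x).symm)

/-- The projections from extended contexts. -/
noncomputable def World.extendProj (l : List A) : World.extend l ⟶ 𝟭 (World A) where
  app _ := { base_subset := subset_rfl, terms := fun _ x => .var (x.inr l) }
  naturality _ _ f := World.Hom.ext (funext fun _ => funext fun x =>
    (Substitution.lift_inr f.terms x l).trans (Derivation.rename_eq_subst _ _))

/-- The presheaf `(B, c) ↦ F (B, l ++ c)`; for atomic `F` these are the premises of a rule that
discharges `l`. -/
noncomputable abbrev shift (l : List A) (F : Presheaf A) : Presheaf A :=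
  (World.extend l).op ⋙ F

/-- Weakening of the context by `l`. -/
noncomputable def shift.weaken (l : List A) (F : Presheaf A) : F ⟶ shift l F :=
  Functor.whiskerRight (NatTrans.op (World.extendProj l)) F

/-- The variable `x` of the extension `l`, as a constant natural transformation. -/
noncomputable def shift.newVar {l : List A} {a : A} (x : Var l a) (F : Presheaf A) :
    F ⟶ shift l (atomPresheaf a) where
  app w := ↾fun _ => Derivation.var (x.inl w.unop.ctx)
  naturality v w f := by
    ext
    exact (Substitution.lift_inl f.unop.terms x).symm

/-- Substitution of a new variable for an argument of type `a`. -/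
noncomputable def shift.discharge {l : List A} {a : A} (x : Var l a) {F G : Presheaf A}
    (η : prod F (atomPresheaf a) ⟶ G) : F ⟶ shift l G :=
  prod.lift (shift.weaken l F) (shift.newVar x F) ≫ Functor.whiskerLeft (World.extend l).op η

/-- Application of an atomic rule that belongs to the base of every world over which `F` is
inhabited. -/
noncomputable def atomPresheaf.ofRule {R : AtomicRule A} {F : Presheaf A}
    (hR : ∀ w, F.obj w → R ∈ w.unop.base)
    (η : ∀ k : Fin R.premises.length,
      F ⟶ shift (R.premises.get k).1.toList (atomPresheaf (R.premises.get k).2)) :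
    F ⟶ atomPresheaf R.conclusion where
  app w := ↾fun x => Derivation.app R (hR w x) fun k => (η k).app w x
  naturality v w f := by
    ext x
    exact congrArg (Derivation.app R _) (funext fun k => NatTrans.naturality_apply (η k) f x)

/-! ### Entailment between presheaves over a world -/

/-- `F` entails `G` over `w` if the exponential `F ⊃ G` has an element at `w`, that is, if there is
a map from `F` to `G` natural in the worlds over `w`. -/
def EntailsOver (w : World A) (F G : Presheaf A) : Prop :=
  Nonempty (prod (yoneda.obj w) F ⟶ G)

namespace EntailsOver

variable {w : World A} {F G H : Presheaf A}

theorem of_hom (η : F ⟶ G) : EntailsOver w F G := ⟨prod.snd ≫ η⟩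

theorem refl : EntailsOver w F F := of_hom (𝟙 F)

theorem trans : EntailsOver w F G → EntailsOver w G H → EntailsOver w F H :=
  fun ⟨η⟩ ⟨θ⟩ => ⟨prod.lift prod.fst η ≫ θ⟩

theorem fst : EntailsOver w (prod F G) F := of_hom prod.fst

theorem snd : EntailsOver w (prod F G) G := of_hom prod.snd

theorem pair : EntailsOver w H F → EntailsOver w H G → EntailsOver w H (prod F G) :=
  fun ⟨η⟩ ⟨θ⟩ => ⟨prod.lift η θ⟩

theorem mp : EntailsOver w H (expPresheaf F G) → EntailsOver w H F → EntailsOver w H G :=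
  fun ⟨η⟩ ⟨θ⟩ => ⟨prod.lift η θ ≫ expPresheaf.eval F G⟩

theorem forall_intro {K : A → Presheaf A} (h : ∀ p, EntailsOver w H (K p)) :
    EntailsOver w H (forallPresheaf K) :=
  ⟨forallPresheaf.lift fun p => (h p).some⟩

theorem forall_elim {K : A → Presheaf A} (h : EntailsOver w H (forallPresheaf K)) (p : A) :
    EntailsOver w H (K p) :=
  h.trans (of_hom (forallPresheaf.proj K p))

theorem weaken (l : List A) (h : EntailsOver w H G) : EntailsOver w H (shift l G) :=
  h.trans (of_hom (shift.weaken l G))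

theorem curry : EntailsOver w (prod H F) G → EntailsOver w H (expPresheaf F G) :=
  fun ⟨η⟩ => ⟨expPresheaf.curry (prodAssoc _ _ _ ≫ η)⟩

theorem discharge {l : List A} {a : A} (ha : a ∈ l) :
    EntailsOver w (prod H (atomPresheaf a)) G → EntailsOver w H (shift l G) :=
  fun ⟨η⟩ => ⟨shift.discharge (Var.nonempty_of_mem ha).some
    (prodAssoc _ _ _ ≫ η)⟩

theorem of_rule {R : AtomicRule A} (hR : R ∈ w.base)
    (h : ∀ P ∈ R.premises, EntailsOver w H (shift P.1.toList (atomPresheaf P.2))) :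
    EntailsOver w H (atomPresheaf R.conclusion) :=
  ⟨atomPresheaf.ofRule (fun _ x => x.1.base_subset hR) fun k => (h _ (R.premises.get_mem k)).some⟩

theorem nonempty_obj : EntailsOver w F G → Nonempty (F.obj (op w)) → Nonempty (G.obj (op w)) :=
  fun ⟨η⟩ ⟨x⟩ => ⟨η.app (op w) (𝟙 w, x)⟩

end EntailsOver

/-- Mutual entailment over a world. -/
def EquivOver (w : World A) (F G : Presheaf A) : Prop :=
  EntailsOver w F G ∧ EntailsOver w G F

/-! ### The base of sound rules -/

/-- The rules that are admissible in NJ in the presence of `Γ` when every atom `p` is read as the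
formula `dec p`. Admissibility over all `Δ ⊇ Γ` allows the use of a rule under further
assumptions. -/
def soundBase (Γ : Set (Formula A)) (dec : A → Formula A) : Base A :=
  {R | ∀ Δ, Γ ⊆ Δ →
    (∀ P ∈ R.premises, NJ (Δ ∪ dec '' P.1) (dec P.2)) → NJ Δ (dec R.conclusion)}

/-- The base of sound rules with the empty context. -/
def soundWorld (Γ : Set (Formula A)) (dec : A → Formula A) : World A :=
  ⟨soundBase Γ dec, []⟩

section SoundWorld

variable {Γ : Set (Formula A)} {dec : A → Formula A}

theorem Derivation.nj_dec {c : List A} {p : A} (Φ : Derivation (soundBase Γ dec) c p) :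
    NJ (Γ ∪ dec '' {q | q ∈ c}) (dec p) := by
  induction Φ with
  | var x => exact .ax (.inr ⟨_, x.mem, rfl⟩)
  | @app c R hR _ ih =>
    refine hR _ Set.subset_union_left fun P hP => ?_
    obtain ⟨k, rfl⟩ := List.get_of_mem hP
    have hctx : dec '' {q | q ∈ (R.premises.get k).1.toList ++ c} =
        dec '' {q | q ∈ c} ∪ dec '' (R.premises.get k).1 := by
      rw [← Set.image_union]
      congr 1
      ext q
      simp [or_comm]
    simpa only [hctx, Set.union_assoc] using ih k

theorem nj_of_nonempty_atomPresheaf {p : A}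
    (h : Nonempty ((atomPresheaf p).obj (op (soundWorld Γ dec)))) : NJ Γ (dec p) := by
  obtain ⟨Φ : Derivation (soundBase Γ dec) [] p⟩ := h
  simpa using Φ.nj_dec

theorem nonempty_atomPresheaf_of_mem {p : A} (hp : dec p ∈ Γ) :
    Nonempty ((atomPresheaf p).obj (op (soundWorld Γ dec))) :=
  ⟨Derivation.app (B := soundBase Γ dec) ⟨[], p⟩ (fun _ hΔ _ => .ax (hΔ hp)) fun k => k.elim0⟩

namespace EntailsOver

variable {F G H : Presheaf A} {a b c : A}

theorem atom_of_nj_imp (sound : ∀ Δ, NJ Δ (dec a) → NJ Δ (dec b))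
    (h : EntailsOver (soundWorld Γ dec) H (atomPresheaf a)) :
    EntailsOver (soundWorld Γ dec) H (atomPresheaf b) := by
  refine of_rule (R := ⟨[(∅, a)], b⟩) (fun Δ _ hΔ => sound Δ (by simpa using hΔ)) ?_
  simpa only [List.forall_mem_singleton] using h.weaken _

theorem atom_of_nj_imp₂ (sound : ∀ Δ, NJ Δ (dec a) → NJ Δ (dec b) → NJ Δ (dec c))
    (ha : EntailsOver (soundWorld Γ dec) H (atomPresheaf a))
    (hb : EntailsOver (soundWorld Γ dec) H (atomPresheaf b)) :
    EntailsOver (soundWorld Γ dec) H (atomPresheaf c) := by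
  refine of_rule (R := ⟨[(∅, a), (∅, b)], c⟩) (fun Δ _ hΔ => ?_) ?_
  · have : NJ Δ (dec a) ∧ NJ Δ (dec b) := by simpa using hΔ
    exact sound Δ this.1 this.2
  · simpa using ⟨ha.weaken _, hb.weaken _⟩

theorem atom_imp_intro (hc : dec c = .imp (dec a) (dec b))
    (h : EntailsOver (soundWorld Γ dec) (prod H (atomPresheaf a)) (atomPresheaf b)) :
    EntailsOver (soundWorld Γ dec) H (atomPresheaf c) := by
  refine of_rule (R := ⟨[({a}, b)], c⟩) (fun Δ _ hΔ => ?_) ?_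
  · rw [hc]
    exact .impI (by simpa using hΔ)
  · simpa only [List.forall_mem_singleton] using h.discharge (by simp)

theorem atom_or_elim {p : A} (hc : dec c = .or (dec a) (dec b))
    (h : EntailsOver (soundWorld Γ dec) H (atomPresheaf c))
    (ha : EntailsOver (soundWorld Γ dec) (prod H (atomPresheaf a)) (atomPresheaf p))
    (hb : EntailsOver (soundWorld Γ dec) (prod H (atomPresheaf b)) (atomPresheaf p)) :
    EntailsOver (soundWorld Γ dec) H (atomPresheaf p) := by
  refine of_rule (R := ⟨[(∅, c), ({a}, p), ({b}, p)], p⟩) (fun Δ _ hΔ => ?_) ?_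
  · have ⟨hΔ, hΔa, hΔb⟩ : NJ Δ (.or (dec a) (dec b)) ∧ NJ (insert (dec a) Δ) (dec p) ∧
        NJ (insert (dec b) Δ) (dec p) := by simpa [hc] using hΔ
    exact .orE hΔ hΔa hΔb
  · simp only [List.forall_mem_cons, List.not_mem_nil, IsEmpty.forall_iff, implies_true, and_true]
    exact ⟨h.weaken _, ha.discharge (by simp), hb.discharge (by simp)⟩

end EntailsOver

namespace EquivOver

open EntailsOver

variable {φ ψ : Formula A} {a b c : A}

theorem sem_bot (hc : dec c = .bot) :
    EquivOver (soundWorld Γ dec) (sem .bot) (atomPresheaf c) :=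
  ⟨.forall_elim .refl c, .forall_intro fun _ => .atom_of_nj_imp (fun _ h => .botE (hc ▸ h)) .refl⟩

theorem sem_and (hc : dec c = .and (dec a) (dec b))
    (hφ : EquivOver (soundWorld Γ dec) (sem φ) (atomPresheaf a))
    (hψ : EquivOver (soundWorld Γ dec) (sem ψ) (atomPresheaf b)) :
    EquivOver (soundWorld Γ dec) (sem (.and φ ψ)) (atomPresheaf c) := by
  constructor
  · exact .atom_of_nj_imp₂ (fun _ ha hb => hc ▸ .andI ha hb) (fst.trans hφ.1) (snd.trans hψ.1)
  · have ha : EntailsOver (soundWorld Γ dec) (atomPresheaf c) (atomPresheaf a) :=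
      .atom_of_nj_imp (fun _ h => .andE₁ (hc ▸ h)) .refl
    have hb : EntailsOver (soundWorld Γ dec) (atomPresheaf c) (atomPresheaf b) :=
      .atom_of_nj_imp (fun _ h => .andE₂ (hc ▸ h)) .refl
    exact .pair (ha.trans hφ.2) (hb.trans hψ.2)

theorem sem_or (hc : dec c = .or (dec a) (dec b))
    (hφ : EquivOver (soundWorld Γ dec) (sem φ) (atomPresheaf a))
    (hψ : EquivOver (soundWorld Γ dec) (sem ψ) (atomPresheaf b)) :
    EquivOver (soundWorld Γ dec) (sem (.or φ ψ)) (atomPresheaf c) := by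
  constructor
  · have inl : EntailsOver (soundWorld Γ dec) (sem φ) (atomPresheaf c) :=
      hφ.1.atom_of_nj_imp fun _ h => hc ▸ .orI₁ h
    have inr : EntailsOver (soundWorld Γ dec) (sem ψ) (atomPresheaf c) :=
      hψ.1.atom_of_nj_imp fun _ h => hc ▸ .orI₂ h
    exact ((forall_elim .refl c).mp (.curry (snd.trans inl))).mp (.curry (snd.trans inr))
  · refine .forall_intro fun p => .curry (.curry (.atom_or_elim hc (fst.trans fst) ?_ ?_))
    · exact (fst.trans (fst.trans snd)).mp (snd.trans hφ.2)
    · exact (fst.trans snd).mp (snd.trans hψ.2)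

theorem sem_imp (hc : dec c = .imp (dec a) (dec b))
    (hφ : EquivOver (soundWorld Γ dec) (sem φ) (atomPresheaf a))
    (hψ : EquivOver (soundWorld Γ dec) (sem ψ) (atomPresheaf b)) :
    EquivOver (soundWorld Γ dec) (sem (.imp φ ψ)) (atomPresheaf c) := by
  constructor
  · exact .atom_imp_intro hc ((fst.mp (snd.trans hφ.2)).trans hψ.1)
  · have mp : EntailsOver (soundWorld Γ dec) (prod (atomPresheaf c) (sem φ)) (atomPresheaf b) :=
      .atom_of_nj_imp₂ (fun _ ha h => .impE ha (hc ▸ h)) (snd.trans hφ.1) fst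
    exact .curry (mp.trans hψ.2)

end EquivOver

end SoundWorld

/-! ### Decodings -/

/-- The subformulae of a formula, including the formula itself. -/
def Formula.subformulas : Formula A → Set (Formula A)
  | .atom p => {.atom p}
  | .bot => {.bot}
  | .and φ ψ => insert (.and φ ψ) (φ.subformulas ∪ ψ.subformulas)
  | .or φ ψ => insert (.or φ ψ) (φ.subformulas ∪ ψ.subformulas)
  | .imp φ ψ => insert (.imp φ ψ) (φ.subformulas ∪ ψ.subformulas)

theorem Formula.mem_subformulas_self (φ : Formula A) : φ ∈ φ.subformulas := by
  cases φ <;> simp [Formula.subformulas]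

theorem Formula.finite_subformulas (φ : Formula A) : φ.subformulas.Finite := by
  induction φ with
  | atom p => exact Set.finite_singleton _
  | bot => exact Set.finite_singleton _
  | and φ ψ hφ hψ | or φ ψ hφ hψ | imp φ ψ hφ hψ => exact (hφ.union hψ).insert _

/-- The subformulae of the members of a set of formulae. -/
def subformulaClosure (Γ : Set (Formula A)) : Set (Formula A) :=
  ⋃ φ ∈ Γ, φ.subformulas

/-- The atoms that do not occur in a set of formulae. -/
def freshAtoms (Γ : Set (Formula A)) : Set A :=
  {p | .atom p ∉ subformulaClosure Γ}

open Cardinal in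
theorem mk_subformulaClosure_le_mk_freshAtoms [Infinite A] {Γ : Set (Formula A)} (hΓ : Γ.Finite) :
    #(subformulaClosure Γ) ≤ #(freshAtoms Γ) := by
  have hT : (subformulaClosure Γ).Finite := hΓ.biUnion fun φ _ => φ.finite_subformulas
  have hocc : {p : A | .atom p ∈ subformulaClosure Γ}.Finite :=
    hT.preimage fun p _ q _ h => Formula.atom.inj h
  have : Infinite (freshAtoms Γ) := hocc.infinite_compl.to_subtype
  exact hT.lt_aleph0.le.trans (aleph0_le_mk _)

/-- `dec` reads atoms as formulae so that every member of `T` is the reading of some atom, while the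
atoms in `T` are read as themselves. -/
structure IsDecoding (dec : A → Formula A) (T : Set (Formula A)) : Prop where
  subset_range : T ⊆ Set.range dec
  dec_atom : ∀ p, .atom p ∈ T → dec p = .atom p

open Cardinal in
theorem exists_isDecoding {Γ : Set (Formula A)} (h : #(subformulaClosure Γ) ≤ #(freshAtoms Γ)) :
    ∃ dec, IsDecoding dec (subformulaClosure Γ) := by
  obtain ⟨code⟩ := (le_def _ _).1 h
  let atomCode (χ : subformulaClosure Γ) : A := code χ
  have hinj : atomCode.Injective := Subtype.val_injective.comp code.injective
  refine ⟨Function.extend atomCode Subtype.val .atom, fun χ hχ => ⟨atomCode ⟨χ, hχ⟩, ?_⟩,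
    fun p hp => Function.extend_apply' _ _ _ ?_⟩
  · exact hinj.extend_apply _ _ _
  · rintro ⟨χ, rfl⟩
    exact (code χ).2 hp

theorem IsDecoding.exists_equivOver {dec : A → Formula A} {T : Set (Formula A)}
    (h : IsDecoding dec T) (Γ : Set (Formula A)) {χ : Formula A} (hχ : χ.subformulas ⊆ T) :
    ∃ c, dec c = χ ∧ EquivOver (soundWorld Γ dec) (sem χ) (atomPresheaf c) := by
  induction χ with
  | atom p => exact ⟨p, h.dec_atom p (hχ (Formula.mem_subformulas_self _)), .refl, .refl⟩
  | bot =>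
    obtain ⟨c, hc⟩ := h.subset_range (hχ (Formula.mem_subformulas_self _))
    exact ⟨c, hc, .sem_bot hc⟩
  | and φ ψ ihφ ihψ =>
    have ⟨hφT, hψT⟩ := Set.union_subset_iff.1 ((Set.subset_insert _ _).trans hχ)
    obtain ⟨a, rfl, hφ⟩ := ihφ hφT
    obtain ⟨b, rfl, hψ⟩ := ihψ hψT
    obtain ⟨c, hc⟩ := h.subset_range (hχ (Formula.mem_subformulas_self _))
    exact ⟨c, hc, .sem_and hc hφ hψ⟩
  | or φ ψ ihφ ihψ =>
    have ⟨hφT, hψT⟩ := Set.union_subset_iff.1 ((Set.subset_insert _ _).trans hχ)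
    obtain ⟨a, rfl, hφ⟩ := ihφ hφT
    obtain ⟨b, rfl, hψ⟩ := ihψ hψT
    obtain ⟨c, hc⟩ := h.subset_range (hχ (Formula.mem_subformulas_self _))
    exact ⟨c, hc, .sem_or hc hφ hψ⟩
  | imp φ ψ ihφ ihψ =>
    have ⟨hφT, hψT⟩ := Set.union_subset_iff.1 ((Set.subset_insert _ _).trans hχ)
    obtain ⟨a, rfl, hφ⟩ := ihφ hφT
    obtain ⟨b, rfl, hψ⟩ := ihψ hψT
    obtain ⟨c, hc⟩ := h.subset_range (hχ (Formula.mem_subformulas_self _))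
    exact ⟨c, hc, .sem_imp hc hφ hψ⟩

end CatPTS

open CatPTS Cardinal in
theorem mainTheorem2_general {A : Type u} (Γ : Set (Formula A)) (φ : Formula A)
    (hcard : #(subformulaClosure (insert φ Γ)) ≤ #(freshAtoms (insert φ Γ)))
    (h : ∀ w, Nonempty ((semSet Γ).obj w) → Nonempty ((sem φ).obj w)) : NJ Γ φ := by
  obtain ⟨dec, hdec⟩ := exists_isDecoding hcard
  have hcode : ∀ ψ ∈ insert φ Γ,
      ∃ p, dec p = ψ ∧ EquivOver (soundWorld Γ dec) (sem ψ) (atomPresheaf p) :=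
    fun ψ hψ => hdec.exists_equivOver Γ (Set.subset_biUnion_of_mem (u := Formula.subformulas) hψ)
  have hΓ : ∀ ψ : Γ, Nonempty ((sem ψ.1).obj (.op (soundWorld Γ dec))) := by
    rintro ⟨ψ, hψ⟩
    obtain ⟨p, rfl, hp⟩ := hcode ψ (.inr hψ)
    exact hp.2.nonempty_obj (nonempty_atomPresheaf_of_mem hψ)
  obtain ⟨p, rfl, hp⟩ := hcode φ (.inl rfl)
  exact nj_of_nonempty_atomPresheaf (hp.1.nonempty_obj (h _ ⟨fun ψ => (hΓ ψ).some⟩))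

theorem mainTheorem2 {A : Type u} [Infinite A] (Γ : Set (CatPTS.Formula A)) (hΓ : Γ.Finite)
    (φ : CatPTS.Formula A) (h : CatPTS.Entails Γ φ) : CatPTS.NJ Γ φ :=
  mainTheorem2_general Γ φ (CatPTS.mk_subformulaClosure_le_mk_freshAtoms (hΓ.insert φ))
    fun w ⟨x⟩ => ⟨h.some.app w x⟩
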